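/- Let $m\ge1$. There is a constant $C_m<\infty$, depending only on $m$, such that the following holds. Let $N\ge0$, let $z_1,\dots,z_N$ be iid random variables with values in a measurable space $\mathsf Z$ and with common law $F$, defined on a probability space $(\Omega,\mathbb P)$ with expectation $\mathbb E$, and let $Y_N=f(z_1,\dots,z_N)$ be a bounded random variable, with $f:\mathsf Z^N\to\mathbb R$ measurable. Then $$|\kappa_{m+1}(Y_N)|\;\le\;C_m\sum_{k=0}^{m-1}N^{k+1}\sum_{\substack{a_1,\dots,a_{m+1}\ge1\\ a_1+\dots+a_{m+1}=m+k+1}}\ \prod_{j=1}^{m+1}\big\|D^{a_j}Y_N\big\|_{\ell^\infty_{\ne}(L^{(m+k+1)/a_j}(\Omega))}.$$ Here $\kappa_n(Y)=\big(\tfrac{d}{dt}\big)^n\log\mathbb E[e^{tY}]\big|_{t=0}$ is the $n$-th cumulant. For a function $Y=Y(z_1,\dots,z_N)$ of the data, the Glauber derivative with respect to $z_j$ is $D_jY=Y-\mathbb E_j[Y]$, where $\mathbb E_j$ denotes integration with respect to the variable $z_j$ only, that is, $\mathbb E_j[Y](z_1,\dots,z_N)=\int_{\mathsf Z}Y(z_1,\dots,z_{j-1},\xi,z_{j+1},\dots,z_N)\,dF(\xi)$.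 Finally, $$\|D^nY\|_{\ell^\infty_{\ne}(L^p(\Omega))}=\sup_{j_1,\dots,j_n\in\{1,\dots,N\}\ \text{distinct}}\|D_{j_1}\cdots D_{j_n}Y\|_{L^p(\Omega)},$$ with the convention that the supremum is $0$ if $n>N$. -/

import Mathlib

open MeasureTheory ProbabilityTheory
open scoped ENNReal NNReal

/-- The `m`-th cumulant `κ_m[Y] = (d/dt)^m log 𝔼[exp (t Y)]` at `t = 0`
(`cgf Y P t` is `log 𝔼[exp (t Y)]`). -/
noncomputable def cumulant {Ω : Type*} [MeasurableSpace Ω] (m : ℕ) (Y : Ω → ℝ)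
    (P : Measure Ω) : ℝ :=
  iteratedDeriv m (cgf Y P) 0

/-- `𝔼_k`: integration with respect to the `k`-th variable only, this variable having law `F`;
it acts on functions `f` of the data `(z_i)_i`. -/
noncomputable def glauberExp {ι Z : Type*} [DecidableEq ι] [MeasurableSpace Z] (F : Measure Z)
    (k : ι) (f : (ι → Z) → ℝ) : (ι → Z) → ℝ :=
  fun x => ∫ ξ, f (Function.update x k ξ) ∂F

/-- The Glauber derivative `D_k f = f - 𝔼_k f`. -/
noncomputable def glauberDeriv {ι Z : Type*} [DecidableEq ι] [MeasurableSpace Z] (F : Measure Z)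
    (k : ι) (f : (ι → Z) → ℝ) : (ι → Z) → ℝ :=
  fun x => f x - glauberExp F k f x

/-- The iterated Glauber derivative `D_{j₁} (D_{j₂} (⋯ (D_{jₙ} f)))` along a list
`[j₁, …, jₙ]` of indices. -/
noncomputable def iterGlauberDeriv {ι Z : Type*} [DecidableEq ι] [MeasurableSpace Z]
    (F : Measure Z) : List ι → ((ι → Z) → ℝ) → ((ι → Z) → ℝ)
  | [], f => f
  | j :: l, f => glauberDeriv F j (iterGlauberDeriv F l f)

/-- The norm `‖D^n Y‖` in `ℓ^∞_{≠}(L^p(Ω))` of `Y = f ((z_i)_i)`: the supremum, over all tuples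
`(j₁, …, jₙ)` of pairwise distinct indices, of the `L^p(Ω)` norm of `D_{j₁} ⋯ D_{jₙ} Y`
(the supremum over the empty set is `0`). -/
noncomputable def glauberNorm {ι Z Ω : Type*} [DecidableEq ι] [MeasurableSpace Z]
    [MeasurableSpace Ω] (P : Measure Ω) (F : Measure Z) (z : ι → Ω → Z) (n : ℕ) (p : ℝ≥0∞)
    (f : (ι → Z) → ℝ) : ℝ≥0∞ :=
  ⨆ j : Fin n ↪ ι,
    eLpNorm (fun ω => iterGlauberDeriv F (List.ofFn j) f (fun i => z i ω)) p P

/-!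
The cumulant of order `m + 1` of `Y` is a joint cumulant of `m + 1` factors equal to `Y`, that is, a
linear combination over partitions `π` of `Fin (m + 1)` of mixed moments in which factors in the
same class of `π` read the same data, and factors in different classes read independent data
(`cumulant_eq_sum_partitionMoment`). The coefficients `cumulantWeight π` are characterised by the
fact that their sum over the partitions coarser than `ρ` is `1` if `ρ` has a single class and `0`
otherwise (`sum_cumulantWeight`).

The coordinates are then disclosed one at a time, from the last to the first. Let `ρ` be the
partition recording which factors have been connected so far. The law of total cumulance
(`partialCumulant_succ`), which is Möbius inversion in the lattice of partitions, says that at the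
`j`-th coordinate either `ρ` stays the same, at no cost, or it is replaced by a strictly coarser
`ρ'`. In the latter case, write each factor as the sum of its average over the `j`-th coordinate and its
Glauber derivative. By Weisner's theorem (`sum_partitionMoebius_mul_eq_zero`), only those terms
survive in which each class that gets merged contains a differentiated factor. So there are at least
`|ρ| - |ρ'| + 1` derivatives (`card_quotient_add_one_le`), and a factor receives one the first time
it is connected to another.

At the end all factors are connected. If this took `k + 1` mergers, at distinct coordinates, then
`k < m`, there are at most `N ^ (k + 1)` choices of these coordinates, every factor
has been differentiated, and there are at least `m + k + 1` derivatives in total. Since a Glauber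
derivative is bounded on `L^p`, superfluous derivatives can be dropped, to leave exactly `m + k + 1`
of them (`exists_le_sum_eq`), and Hölder's inequality with exponents `(m + k + 1) / a i` gives the
corresponding term of the bound (`abs_partitionMoment_le`).
-/

/-! ### Glauber calculus for bounded functions on a product space -/

/-- Bounded measurable real functions. -/
def BddMeas {X : Type*} [MeasurableSpace X] (g : X → ℝ) : Prop :=
  Measurable g ∧ ∃ M : ℝ, ∀ x, |g x| ≤ M

namespace BddMeas

variable {X : Type*} [MeasurableSpace X] {g h : X → ℝ}

lemma integrable (hg : BddMeas g) (μ : Measure X) [IsFiniteMeasure μ] : Integrable g μ := by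
  obtain ⟨hm, M, hM⟩ := hg
  exact Integrable.of_bound hm.aestronglyMeasurable M (.of_forall hM)

lemma comp {Y : Type*} [MeasurableSpace Y] (hg : BddMeas g) {φ : Y → X} (hφ : Measurable φ) :
    BddMeas (fun y => g (φ y)) :=
  ⟨hg.1.comp hφ, hg.2.imp fun _ hM y => hM (φ y)⟩

lemma sub (hg : BddMeas g) (hh : BddMeas h) : BddMeas (fun x => g x - h x) := by
  obtain ⟨hm, M, hM⟩ := hg
  obtain ⟨hm', M', hM'⟩ := hh
  exact ⟨hm.sub hm', M + M', fun x => (abs_sub _ _).trans (add_le_add (hM x) (hM' x))⟩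

lemma prod {I : Type*} [Fintype I] {g : I → X → ℝ} (hg : ∀ i, BddMeas (g i)) :
    BddMeas (fun x => ∏ i, g i x) := by
  choose hm M hM using hg
  refine ⟨Finset.measurable_prod _ fun i _ => hm i, ∏ i, M i, fun x => ?_⟩
  rw [Finset.abs_prod]
  exact Finset.prod_le_prod (fun _ _ => abs_nonneg _) fun i _ => hM i x

end BddMeas

section Glauber

variable {ι Z : Type*} [DecidableEq ι] [MeasurableSpace Z] (F : Measure Z)

lemma iterGlauberDeriv_append (l l' : List ι) (g : (ι → Z) → ℝ) :
    iterGlauberDeriv F (l ++ l') g = iterGlauberDeriv F l (iterGlauberDeriv F l' g) := by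
  induction l with
  | nil => rfl
  | cons j l ih => simp [iterGlauberDeriv, ih]

lemma glauberExp_update (g : (ι → Z) → ℝ) (k : ι) (x : ι → Z) (ξ : Z) :
    glauberExp F k g (Function.update x k ξ) = glauberExp F k g x := by
  simp [glauberExp]

lemma eLpNorm_iterGlauberDeriv_le_glauberNorm {Ω : Type*} [MeasurableSpace Ω] (P : Measure Ω)
    (z : ι → Ω → Z) (g : (ι → Z) → ℝ) {l : List ι} (hl : l.Nodup) (p : ℝ≥0∞) :
    eLpNorm (fun ω => iterGlauberDeriv F l g (fun i => z i ω)) p P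
      ≤ glauberNorm P F z l.length p g := by
  have := le_iSup (fun j : Fin l.length ↪ ι => eLpNorm (fun ω => iterGlauberDeriv F (List.ofFn j) g
    (fun i => z i ω)) p P) ⟨l.get, List.nodup_iff_injective_get.1 hl⟩
  have e : List.ofFn l.get = l := List.ofFn_get l
  simp only [Function.Embedding.coeFn_mk, e] at this
  exact this

variable [IsProbabilityMeasure F] {g : (ι → Z) → ℝ}

lemma BddMeas.glauberExp (hg : BddMeas g) (k : ι) : BddMeas (glauberExp F k g) := by
  obtain ⟨hm, M, hM⟩ := hg
  refine ⟨?_, M, fun x => ?_⟩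
  · have : Measurable (fun q : (ι → Z) × Z => g (Function.update q.1 k q.2)) :=
      hm.comp measurable_update'
    exact this.stronglyMeasurable.integral_prod_right.measurable
  · have := norm_integral_le_of_norm_le_const (μ := F) (f := fun ξ => g (Function.update x k ξ))
      (C := M) (.of_forall fun ξ => hM _)
    simpa [_root_.glauberExp] using this

lemma BddMeas.glauberDeriv (hg : BddMeas g) (k : ι) : BddMeas (glauberDeriv F k g) :=
  hg.sub (hg.glauberExp F k)

lemma BddMeas.iterGlauberDeriv (hg : BddMeas g) (l : List ι) : BddMeas (iterGlauberDeriv F l g) := by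
  induction l with
  | nil => exact hg
  | cons j l ih => exact ih.glauberDeriv F j

lemma glauberExp_comm (hg : BddMeas g) {j k : ι} (hjk : j ≠ k) :
    glauberExp F j (glauberExp F k g) = glauberExp F k (glauberExp F j g) := by
  funext x
  have hb : BddMeas fun q : Z × Z => g (Function.update (Function.update x j q.1) k q.2) :=
    hg.comp (measurable_update'.comp
      (((measurable_update x).comp measurable_fst).prodMk measurable_snd))
  simp only [glauberExp]
  rw [integral_integral_swap (hb.integrable _)]
  simp only [Function.update_comm hjk]

lemma glauberDeriv_glauberExp_comm (hg : BddMeas g) {j k : ι} (hjk : j ≠ k) :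
    glauberDeriv F j (glauberExp F k g) = glauberExp F k (glauberDeriv F j g) := by
  have h := glauberExp_comm F hg hjk
  funext x
  have h1 := (hg.comp (measurable_update x (a := k))).integrable F
  have h2 := ((hg.glauberExp F j).comp (measurable_update x (a := k))).integrable F
  simp only [glauberDeriv, h]
  exact (integral_sub h1 h2).symm

lemma iterGlauberDeriv_glauberExp_comm (hg : BddMeas g) {k : ι} {l : List ι} (hl : ∀ j ∈ l, j ≠ k) :
    iterGlauberDeriv F l (glauberExp F k g) = glauberExp F k (iterGlauberDeriv F l g) := by
  induction l with
  | nil => rfl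
  | cons j l ih =>
    rw [iterGlauberDeriv, iterGlauberDeriv, ih fun i hi => hl i (by simp [hi]),
      glauberDeriv_glauberExp_comm F (hg.iterGlauberDeriv F l) (hl j (by simp))]

variable [Fintype ι]

/-- Resampling one coordinate of an iid family preserves its law. -/
lemma measurePreserving_resample (k : ι) :
    MeasurePreserving (fun q : (ι → Z) × Z => Function.update q.1 k q.2)
      ((Measure.pi fun _ : ι => F).prod F) (Measure.pi fun _ : ι => F) := by
  refine ⟨measurable_update', (Measure.pi_eq fun s hs => ?_).symm⟩
  rw [Measure.map_apply measurable_update' (.univ_pi hs)]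
  have : (fun q : (ι → Z) × Z => Function.update q.1 k q.2) ⁻¹' Set.univ.pi s
      = (Set.univ.pi (Function.update s k Set.univ)) ×ˢ s k := by
    ext ⟨x, ξ⟩
    simp only [Set.mem_preimage, Set.mem_pi, Set.mem_univ, true_implies, Set.mem_prod]
    constructor
    · intro h
      refine ⟨fun i => ?_, by simpa using h k⟩
      by_cases hi : i = k
      · subst hi; simp
      · simpa [hi] using h i
    · rintro ⟨h, h'⟩ i
      by_cases hi : i = k
      · subst hi; simpa using h'
      · simpa [hi] using h i
  rw [this, Measure.prod_prod, Measure.pi_pi, ← Finset.mul_prod_erase _ _ (Finset.mem_univ k),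
    ← Finset.mul_prod_erase _ (fun i => F (s i)) (Finset.mem_univ k)]
  rw [Function.update_self, measure_univ, one_mul, mul_comm]
  congr 1
  exact Finset.prod_congr rfl fun i hi => by rw [Function.update_of_ne (Finset.ne_of_mem_erase hi)]

/-- Averaging over one coordinate is a contraction of `L^p`. -/
lemma eLpNorm_glauberExp_le (hg : BddMeas g) (k : ι) {p : ℝ≥0∞} (hp : 1 ≤ p) (hp' : p ≠ ∞) :
    eLpNorm (glauberExp F k g) p (Measure.pi fun _ : ι => F)
      ≤ eLpNorm g p (Measure.pi fun _ : ι => F) := by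
  have hp0 : p ≠ 0 := (zero_lt_one.trans_le hp).ne'
  have hpos : 0 < p.toReal := ENNReal.toReal_pos hp0 hp'
  rw [eLpNorm_eq_lintegral_rpow_enorm_toReal hp0 hp', eLpNorm_eq_lintegral_rpow_enorm_toReal hp0 hp']
  refine ENNReal.rpow_le_rpow ?_ (by positivity)
  have hmeas : Measurable fun x => ‖g x‖ₑ ^ p.toReal := hg.1.enorm.pow_const _
  rw [← (measurePreserving_resample F k).lintegral_comp hmeas,
    lintegral_prod (fun q : (ι → Z) × Z => ‖g (Function.update q.1 k q.2)‖ₑ ^ p.toReal)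
      (hmeas.comp (measurePreserving_resample F k).measurable).aemeasurable]
  refine lintegral_mono fun x => ?_
  have hm : Measurable fun ξ => g (Function.update x k ξ) := hg.1.comp (measurable_update x)
  calc ‖glauberExp F k g x‖ₑ ^ p.toReal
      ≤ (∫⁻ ξ, ‖g (Function.update x k ξ)‖ₑ ∂F) ^ p.toReal :=
        ENNReal.rpow_le_rpow (enorm_integral_le_lintegral_enorm _) hpos.le
    _ ≤ (eLpNorm (fun ξ => g (Function.update x k ξ)) p F) ^ p.toReal := by
        refine ENNReal.rpow_le_rpow ?_ hpos.le
        rw [← eLpNorm_one_eq_lintegral_enorm]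
        exact eLpNorm_le_eLpNorm_of_exponent_le hp hm.aestronglyMeasurable
    _ = _ := by
        rw [eLpNorm_eq_lintegral_rpow_enorm_toReal hp0 hp', ← ENNReal.rpow_mul,
          one_div_mul_cancel hpos.ne', ENNReal.rpow_one]

lemma eLpNorm_glauberDeriv_le (hg : BddMeas g) (k : ι) {p : ℝ≥0∞} (hp : 1 ≤ p) (hp' : p ≠ ∞) :
    eLpNorm (glauberDeriv F k g) p (Measure.pi fun _ : ι => F)
      ≤ 2 * eLpNorm g p (Measure.pi fun _ : ι => F) := by
  rw [two_mul]
  exact (eLpNorm_sub_le hg.1.aestronglyMeasurable (hg.glauberExp F k).1.aestronglyMeasurable hp).trans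
    (add_le_add le_rfl (eLpNorm_glauberExp_le F hg k hp hp'))

lemma glauberExp_congr_ae {g h : (ι → Z) → ℝ} (hgh : g =ᵐ[Measure.pi fun _ : ι => F] h) (k : ι) :
    glauberExp F k g =ᵐ[Measure.pi fun _ : ι => F] glauberExp F k h := by
  have := Measure.ae_ae_of_ae_prod ((measurePreserving_resample F k).quasiMeasurePreserving.ae hgh)
  filter_upwards [this] with x hx
  exact integral_congr_ae hx

lemma iterGlauberDeriv_congr_ae {g h : (ι → Z) → ℝ} (hgh : g =ᵐ[Measure.pi fun _ : ι => F] h)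
    (l : List ι) :
    iterGlauberDeriv F l g =ᵐ[Measure.pi fun _ : ι => F] iterGlauberDeriv F l h := by
  induction l with
  | nil => exact hgh
  | cons j l ih => exact ih.sub (glauberExp_congr_ae F ih j)

/-- Each Glauber derivative costs at most a factor `2`. -/
lemma glauberNorm_succ_le (hg : BddMeas g) (a : ℕ) {p : ℝ≥0∞} (hp : 1 ≤ p) (hp' : p ≠ ∞) :
    glauberNorm (Measure.pi fun _ : ι => F) F (fun i x => x i) (a + 1) p g
      ≤ 2 * glauberNorm (Measure.pi fun _ : ι => F) F (fun i x => x i) a p g := by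
  refine iSup_le fun j => ?_
  have := eLpNorm_glauberDeriv_le F (hg.iterGlauberDeriv F (List.ofFn fun i => j (Fin.succ i)))
    (j 0) hp hp'
  rw [List.ofFn_succ]
  refine this.trans (mul_le_mul_right ?_ 2)
  have h := eLpNorm_iterGlauberDeriv_le_glauberNorm F (Measure.pi fun _ : ι => F)
    (fun i x => x i) g (l := List.ofFn fun i => j (Fin.succ i))
    (List.nodup_ofFn.2 (j.injective.comp (Fin.succ_injective a))) p
  rwa [List.length_ofFn] at h

lemma glauberNorm_le_of_le (hg : BddMeas g) {a b : ℕ} (hab : a ≤ b) {p : ℝ≥0∞} (hp : 1 ≤ p)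
    (hp' : p ≠ ∞) :
    glauberNorm (Measure.pi fun _ : ι => F) F (fun i x => x i) b p g
      ≤ 2 ^ (b - a) * glauberNorm (Measure.pi fun _ : ι => F) F (fun i x => x i) a p g := by
  induction b, hab using Nat.le_induction with
  | base => simp
  | succ b hab ih =>
    refine (glauberNorm_succ_le F hg b hp hp').trans ?_
    rw [Nat.succ_sub hab, pow_succ', mul_assoc]
    exact mul_le_mul_right ih 2

end Glauber

/-! ### Cumulants and the moments of sums of independent copies -/

open scoped ContDiff in
/-- The derivatives of `exp (q * K)` are, up to the factor `exp (q * K)`, polynomials in `q` without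
constant term, whose linear coefficient is the derivative of `K`. -/
lemma exists_iteratedDeriv_exp_mul {K : ℝ → ℝ} (hK : ContDiff ℝ ∞ K) (n : ℕ) :
    ∃ B : ℕ → ℝ → ℝ, (∀ r, ContDiff ℝ ∞ (B r)) ∧ B 0 = 0 ∧ B 1 = iteratedDeriv (n + 1) K ∧
      (∀ r, n + 2 ≤ r → B r = 0) ∧ ∀ q : ℝ, iteratedDeriv (n + 1) (fun t => Real.exp (q * K t)) =
        fun t => (∑ r ∈ Finset.range (n + 2), q ^ r * B r t) * Real.exp (q * K t) := by
  have hdiff {B : ℝ → ℝ} (hB : ContDiff ℝ ∞ B) : ContDiff ℝ ∞ (deriv B) :=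
    (contDiff_infty_iff_deriv.1 hB).2
  have hder {B : ℝ → ℝ} (hB : ContDiff ℝ ∞ B) (t : ℝ) : HasDerivAt B (deriv B t) t :=
    ((hB.differentiable (by simp)) t).hasDerivAt
  have hexp (q t : ℝ) : HasDerivAt (fun t => Real.exp (q * K t))
      (Real.exp (q * K t) * (q * deriv K t)) t := ((hder hK t).const_mul q).exp
  induction n with
  | zero =>
    refine ⟨fun r => if r = 1 then deriv K else 0, fun r => ?_, by simp, by simp,
      fun r hr => if_neg (by omega), fun q => ?_⟩
    · dsimp only
      split_ifs
      exacts [hdiff hK, contDiff_const]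
    · funext t
      rw [zero_add, iteratedDeriv_one, (hexp q t).deriv]
      simp [Finset.sum_range_succ]
      ring
  | succ n ih =>
    obtain ⟨B, hB, hB0, hB1, hBn, hq⟩ := ih
    refine ⟨fun r => match r with
      | 0 => 0
      | r + 1 => fun t => deriv (B (r + 1)) t + deriv K t * B r t, ?_, rfl, ?_, ?_, fun q => ?_⟩
    · rintro (_ | r)
      · exact contDiff_const
      · exact (hdiff (hB _)).add ((hdiff hK).mul (hB r))
    · funext t
      simp [hB0, hB1, iteratedDeriv_succ (n := n + 1)]
    · rintro (_ | r) hr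
      · rfl
      · funext t
        simp [hBn r (by omega), hBn (r + 1) (by omega)]
    · rw [iteratedDeriv_succ, hq]
      funext t
      have h1 : HasDerivAt (fun t => ∑ r ∈ Finset.range (n + 2), q ^ r * B r t)
          (∑ r ∈ Finset.range (n + 2), q ^ r * deriv (B r) t) t :=
        HasDerivAt.fun_sum fun r _ => (hder (hB r) t).const_mul _
      rw [(h1.fun_mul (hexp q t)).deriv, Finset.sum_range_succ' _ (n + 2)]
      have h2 : ∑ r ∈ Finset.range (n + 2), q ^ r * deriv (B r) t
          = ∑ r ∈ Finset.range (n + 2), q ^ (r + 1) * deriv (B (r + 1)) t := by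
        rw [Finset.sum_range_succ' _ (n + 1), Finset.sum_range_succ _ (n + 1), hB0, hBn _ le_rfl]
        simp
      rw [h2]
      simp only [mul_add, Finset.sum_add_distrib, Pi.zero_apply, mul_zero, add_zero, add_mul,
        Finset.sum_mul]
      congr 1
      refine Finset.sum_congr rfl fun r _ => ?_
      ring

/-- Finitely many evaluations recover the linear coefficient of a polynomial of degree at
most `n`. -/
lemma exists_linearCoeff_weights (n : ℕ) :
    ∃ α : ℕ → ℝ, ∀ r ≤ n, ∑ q ∈ Finset.range (n + 1), α q * (q : ℝ) ^ r = if r = 1 then 1 else 0 := by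
  have hinj : Set.InjOn (fun q : ℕ => (q : ℝ)) (Finset.range (n + 1)) := Nat.cast_injective.injOn
  refine ⟨fun q => (Lagrange.basis (Finset.range (n + 1)) (fun q : ℕ => (q : ℝ)) q).coeff 1,
    fun r hr => ?_⟩
  have h := Lagrange.eq_interpolate (f := (Polynomial.X ^ r : Polynomial ℝ)) hinj (by
    rw [Polynomial.degree_X_pow, Finset.card_range]
    exact_mod_cast Nat.lt_succ_of_le hr)
  have h1 := congrArg (fun p => p.coeff 1) h
  simp only [Lagrange.interpolate_apply, Polynomial.finsetSum_coeff, Polynomial.coeff_C_mul,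
    Polynomial.coeff_X_pow, Polynomial.eval_pow, Polynomial.eval_X] at h1
  rw [← Finset.sum_congr rfl fun q _ => mul_comm _ _, ← h1]
  simp [eq_comm]

section Cumulant

variable {X : Type*} [MeasurableSpace X] (μ : Measure X) [IsProbabilityMeasure μ] {f : X → ℝ}

lemma BddMeas.integrable_exp (hf : BddMeas f) (t : ℝ) :
    Integrable (fun x => Real.exp (t * f x)) μ := by
  obtain ⟨hm, M, hM⟩ := hf
  exact integrable_exp_mul_of_mem_Icc hm.aemeasurable (.of_forall fun x => abs_le.1 (hM x))

lemma BddMeas.integrableExpSet_eq_univ (hf : BddMeas f) : integrableExpSet f μ = Set.univ :=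
  Set.eq_univ_of_forall fun t => hf.integrable_exp μ t

/-- The cumulants as linear combinations of the moments of sums of independent copies: the `n`-th
moment of the sum of `q` copies is a polynomial in `q`, with linear coefficient the cumulant. -/
lemma cumulant_eq_sum_moment (hf : BddMeas f) {n : ℕ} (hn : 1 ≤ n) {α : ℕ → ℝ}
    (hα : ∀ r ≤ n, ∑ q ∈ Finset.range (n + 1), α q * (q : ℝ) ^ r = if r = 1 then 1 else 0) :
    cumulant n f μ = ∑ q ∈ Finset.range (n + 1),
      α q * ∫ x : Fin q → X, (∑ a, f (x a)) ^ n ∂Measure.pi fun _ => μ := by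
  obtain ⟨n, rfl⟩ : ∃ k, n = k + 1 := ⟨n - 1, by omega⟩
  have hK : ContDiff ℝ (⊤ : ℕ∞) (cgf f μ) := by
    have := analyticOnNhd_cgf (X := f) (μ := μ)
    rw [hf.integrableExpSet_eq_univ μ, interior_univ] at this
    exact contDiff_iff_contDiffAt.2 fun x => (this x trivial).contDiffAt
  obtain ⟨B, -, hB0, hB1, -, hq⟩ := exists_iteratedDeriv_exp_mul hK n
  have key (q : ℕ) : ∫ x : Fin q → X, (∑ a, f (x a)) ^ (n + 1) ∂(Measure.pi fun _ => μ)
      = ∑ r ∈ Finset.range (n + 2), (q : ℝ) ^ r * B r 0 := by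
    have hS : BddMeas (fun x : Fin q → X => ∑ a, f (x a)) := by
      obtain ⟨hm, M, hM⟩ := hf
      refine ⟨by fun_prop, ∑ _a : Fin q, M, fun x => ?_⟩
      exact (Finset.abs_sum_le_sum_abs _ _).trans (Finset.sum_le_sum fun a _ => hM _)
    have hmgf : mgf (fun x : Fin q → X => ∑ a, f (x a)) (Measure.pi fun _ => μ)
        = fun t => Real.exp (q * cgf f μ t) := by
      funext t
      have hind : iIndepFun (fun (a : Fin q) (x : Fin q → X) => f (x a)) (Measure.pi fun _ => μ) :=
        iIndepFun_pi fun _ => hf.1.aemeasurable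
      have h1 := hind.mgf_sum (t := t) (fun a => hf.1.comp (measurable_pi_apply a)) Finset.univ
      have h2 (a : Fin q) : mgf (fun x : Fin q → X => f (x a)) (Measure.pi fun _ => μ) t
          = mgf f μ t := by
        have hp := measurePreserving_eval (fun _ : Fin q => μ) a
        conv_rhs => rw [← hp.map_eq]
        have hm : Measurable fun x => Real.exp (t * f x) := (hf.1.const_mul t).exp
        exact (mgf_map hp.measurable.aemeasurable hm.aestronglyMeasurable).symm
      have h3 : (fun x : Fin q → X => ∑ a, f (x a)) = ∑ a, fun x : Fin q → X => f (x a) := by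
        funext x; simp
      rw [h3, h1, Finset.prod_congr rfl fun a _ => h2 a, Finset.prod_const, Finset.card_univ,
        Fintype.card_fin, mul_comm, Real.exp_mul, exp_cgf (hf.integrable_exp μ t), Real.rpow_natCast]
    have h0 := iteratedDeriv_mgf_zero (X := fun x : Fin q → X => ∑ a, f (x a))
      (μ := Measure.pi fun _ => μ) (by rw [hS.integrableExpSet_eq_univ _, interior_univ]; trivial)
      (n + 1)
    rw [hmgf, hq] at h0
    simp only [cgf_zero, mul_zero, Real.exp_zero, mul_one] at h0
    rw [h0]
    rfl
  simp only [key, Finset.mul_sum]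
  rw [Finset.sum_comm]
  have h4 : ∀ r ∈ Finset.range (n + 2), ∑ q ∈ Finset.range (n + 2), α q * ((q : ℝ) ^ r * B r 0)
      = if r = 1 then B 1 0 else 0 := by
    intro r hr
    simp only [← mul_assoc, ← Finset.sum_mul]
    rw [hα r (by simpa [Nat.lt_succ_iff] using hr)]
    split_ifs with h
    · simp [h]
    · simp
  rw [Finset.sum_congr rfl h4, Finset.sum_ite_eq' _ 1, if_pos (by simp), hB1, cumulant]

end Cumulant

/-! ### Mixed moments indexed by partitions -/

noncomputable instance Setoid.fintypeOfFinite {I : Type*} [Finite I] : Fintype (Setoid I) :=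
  haveI : Finite (Setoid I) :=
    Finite.of_injective (fun s : Setoid I => (s.r : I → I → Prop)) fun _ _ h => Setoid.ext fun a b => by
      exact iff_of_eq (congrFun (congrFun h a) b)
  Fintype.ofFinite _

section PartitionMeasure

variable {Z : Type*} [MeasurableSpace Z] (F : Measure Z) [IsProbabilityMeasure F]

lemma map_pi_comp_injective {L L' : Type*} [Fintype L] [Fintype L'] {e : L → L'}
    (he : e.Injective) :
    (Measure.pi fun _ : L' => F).map (fun x a => x (e a)) = Measure.pi fun _ : L => F := by
  have h : iIndepFun (fun (a : L') (x : L' → Z) => x a) (Measure.pi fun _ => F) :=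
    iIndepFun_pi (X := fun _ z => z) fun _ => aemeasurable_id
  rw [(h.precomp he).map_fun_eq_pi_map fun a => (measurable_pi_apply (e a)).aemeasurable]
  congr 1
  funext a
  exact (measurePreserving_eval (fun _ : L' => F) (e a)).map_eq

lemma map_pi_comp_eq_map_quotient {A L : Type*} [Fintype L] (φ : A → L) {π : Setoid A}
    [Fintype (Quotient π)] (hπ : Setoid.ker φ = π) :
    (Measure.pi fun _ : L => F).map (fun x i => x (φ i))
      = (Measure.pi fun _ : Quotient π => F).map (fun x i => x (Quotient.mk π i)) := by
  subst hπ
  rw [← map_pi_comp_injective F (Setoid.kerLift_injective φ),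
    Measure.map_map (by fun_prop) (by fun_prop)]
  rfl

/-- The law of a family obtained by repeating iid variables depends only on which entries are
repetitions of each other. -/
lemma map_pi_comp_eq_of_ker_eq {A L L' : Type*} [Finite A] [Fintype L] [Fintype L'] {φ : A → L}
    {φ' : A → L'} (h : Setoid.ker φ = Setoid.ker φ') :
    (Measure.pi fun _ : L => F).map (fun x i => x (φ i))
      = (Measure.pi fun _ : L' => F).map (fun x i => x (φ' i)) := by
  have := Fintype.ofFinite (Quotient (Setoid.ker φ))
  rw [map_pi_comp_eq_map_quotient F φ rfl, map_pi_comp_eq_map_quotient F φ' h.symm]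

variable {I J : Type*}

lemma ker_out (π : Setoid I) : Setoid.ker (fun i => (Quotient.mk π i).out) = π := by
  ext a b
  simp [Setoid.ker_def, Quotient.eq]

variable [Fintype I]

/-- The law of a family of random variables of law `F`, equal to each other within the classes of
`π` and independent from one class to another. Each class is labelled by one of its elements. -/
noncomputable def partitionMeasure (π : Setoid I) : Measure (I → Z) :=
  (Measure.pi fun _ : I => F).map fun x i => x (Quotient.mk π i).out

lemma map_pi_comp_eq_partitionMeasure {L : Type*} [Fintype L] (φ : I → L) :
    (Measure.pi fun _ : L => F).map (fun x i => x (φ i)) = partitionMeasure F (Setoid.ker φ) :=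
  map_pi_comp_eq_of_ker_eq F (ker_out _).symm

instance (π : Setoid I) : IsProbabilityMeasure (partitionMeasure F π) :=
  Measure.isProbabilityMeasure_map (Measurable.aemeasurable (by fun_prop))

lemma measurePreserving_partitionMeasure (π : Setoid I) (i : I) :
    MeasurePreserving (fun y : I → Z => y i) (partitionMeasure F π) F := by
  refine ⟨measurable_pi_apply i, ?_⟩
  rw [partitionMeasure, Measure.map_map (measurable_pi_apply i) (by fun_prop)]
  exact (measurePreserving_eval (fun _ : I => F) (Quotient.mk π i).out).map_eq

/-- The law of the entries outside a set `c` only depends on the partition outside `c`. -/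
lemma map_partitionMeasure_eq {π π' : Setoid I} {c : Set I} [DecidablePred (· ∈ c)] (z₀ : Z)
    (h : ∀ a b, a ∉ c → b ∉ c → (π a b ↔ π' a b)) :
    (partitionMeasure F π).map (fun y i => if i ∈ c then z₀ else y i)
      = (partitionMeasure F π').map (fun y i => if i ∈ c then z₀ else y i) := by
  have key (π : Setoid I) : (partitionMeasure F π).map (fun y i => if i ∈ c then z₀ else y i)
      = ((Measure.pi fun _ : I => F).map
        (fun x (i : {i // i ∉ c}) => x (Quotient.mk π i.1).out)).map
          (fun y i => if h : i ∈ c then z₀ else y ⟨i, h⟩) := by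
    have hm : Measurable (fun (y : I → Z) i => if i ∈ c then z₀ else y i) := by
      refine measurable_pi_lambda _ fun i => ?_
      split_ifs <;> fun_prop
    have hm' : Measurable (fun (y : {i // i ∉ c} → Z) i => if h : i ∈ c then z₀ else y ⟨i, h⟩) := by
      refine measurable_pi_lambda _ fun i => ?_
      split_ifs <;> fun_prop
    rw [partitionMeasure, Measure.map_map hm (by fun_prop), Measure.map_map hm' (by fun_prop)]
    rfl
  rw [key, key]
  congr 1
  refine map_pi_comp_eq_of_ker_eq F (Setoid.ext fun a b => ?_)
  simpa [Setoid.ker_def, Quotient.eq] using h a b a.2 b.2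

lemma BddMeas.prod_partition {g : I → (J → Z) → ℝ} (hg : ∀ i, BddMeas (g i)) :
    BddMeas fun y : J → I → Z => ∏ i, g i (fun j => y j i) :=
  BddMeas.prod fun i => (hg i).comp (by fun_prop)

variable [Fintype J]

lemma map_pi_swap {L : Type*} [Fintype L] :
    (Measure.pi fun _ : L => Measure.pi fun _ : J => F).map (fun x j a => x a j)
      = Measure.pi fun _ : J => Measure.pi fun _ : L => F := by
  have h1 := Measure.infinitePi_map_curry_symm (fun (_ : L) (_ : J) => F)
  have h2 := Measure.infinitePi_map_piCongrLeft (X := fun _ : J × L => Z) (fun _ => F)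
    (Equiv.prodComm L J)
  have h3 := Measure.infinitePi_map_curry (fun (_ : J) (_ : L) => F)
  simp only [Measure.infinitePi_eq_pi] at h1 h2 h3
  rw [← h3, ← h2, ← h1, Measure.map_map (by fun_prop) (by fun_prop),
    Measure.map_map (by fun_prop) (by fun_prop)]
  congr 1

/-- The mixed moment `𝔼 ∏ i, g i (zⁱ)`, in which the copies `zⁱ` of the data share, or do not
share, their `j`-th entry according to the partition `π j`. -/
noncomputable def partitionMoment (π : J → Setoid I) (g : I → (J → Z) → ℝ) : ℝ :=
  ∫ y : J → I → Z, ∏ i, g i (fun j => y j i) ∂Measure.pi fun j => partitionMeasure F (π j)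

lemma measurePreserving_partition_eval (π : J → Setoid I) (i : I) :
    MeasurePreserving (fun (y : J → I → Z) j => y j i)
      (Measure.pi fun j => partitionMeasure F (π j)) (Measure.pi fun _ => F) :=
  measurePreserving_pi _ _ fun j => measurePreserving_partitionMeasure F (π j) i

lemma partitionMoment_const_ker {L : Type*} [Fintype L] (φ : I → L) {g : I → (J → Z) → ℝ}
    (hg : ∀ i, BddMeas (g i)) :
    ∫ x : L → J → Z, ∏ i, g i (x (φ i)) ∂(Measure.pi fun _ => Measure.pi fun _ => F)
      = partitionMoment F (fun _ => Setoid.ker φ) g := by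
  have h : (Measure.pi fun _ : J => partitionMeasure F (Setoid.ker φ))
      = (Measure.pi fun _ : L => Measure.pi fun _ : J => F).map (fun x j i => x (φ i) j) := by
    simp only [← map_pi_comp_eq_partitionMeasure]
    rw [← Measure.pi_map_pi (fun _ => Measurable.aemeasurable (by fun_prop)), ← map_pi_swap,
      Measure.map_map (by fun_prop) (by fun_prop)]
    rfl
  rw [partitionMoment, h, integral_map (Measurable.aemeasurable (by fun_prop))
    (BddMeas.prod_partition hg).1.aestronglyMeasurable]

/-- Hölder's inequality: a mixed moment is controlled by the marginal laws. -/
lemma abs_partitionMoment_le (π : J → Setoid I) {g : I → (J → Z) → ℝ} (hg : ∀ i, BddMeas (g i))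
    {p : I → ℝ≥0∞} (hp : ∀ i, 1 ≤ p i) (hp' : ∀ i, p i ≠ ∞) (hsum : ∑ i, (p i).toReal⁻¹ = 1) :
    ENNReal.ofReal |partitionMoment F π g|
      ≤ ∏ i, eLpNorm (g i) (p i) (Measure.pi fun _ : J => F) := by
  have hpos (i : I) : 0 < (p i).toReal :=
    ENNReal.toReal_pos (zero_lt_one.trans_le (hp i)).ne' (hp' i)
  have hm (i : I) : Measurable fun x => ‖g i x‖ₑ ^ (p i).toReal := (hg i).1.enorm.pow_const _
  rw [← Real.norm_eq_abs, ofReal_norm]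
  calc ‖partitionMoment F π g‖ₑ
      ≤ ∫⁻ y : J → I → Z, ‖∏ i, g i (fun j => y j i)‖ₑ
          ∂Measure.pi fun j => partitionMeasure F (π j) := enorm_integral_le_lintegral_enorm _
    _ = ∫⁻ y : J → I → Z, ∏ i, (‖g i (fun j => y j i)‖ₑ ^ (p i).toReal) ^ (p i).toReal⁻¹
          ∂Measure.pi fun j => partitionMeasure F (π j) := by
        refine lintegral_congr fun y => ?_
        rw [enorm_eq_nnnorm, nnnorm_prod, ENNReal.ofNNReal_finsetProd]
        refine Finset.prod_congr rfl fun i _ => ?_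
        rw [← ENNReal.rpow_mul, mul_inv_cancel₀ (hpos i).ne', ENNReal.rpow_one, enorm_eq_nnnorm]
    _ ≤ ∏ i, (∫⁻ y : J → I → Z, ‖g i (fun j => y j i)‖ₑ ^ (p i).toReal
          ∂Measure.pi fun j => partitionMeasure F (π j)) ^ (p i).toReal⁻¹ :=
        ENNReal.lintegral_prod_norm_pow_le _
          (fun i _ => ((hm i).comp (measurePreserving_partition_eval F π i).measurable).aemeasurable)
          hsum fun i _ => (inv_pos.2 (hpos i)).le
    _ = _ := by
        refine Finset.prod_congr rfl fun i _ => ?_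
        rw [(measurePreserving_partition_eval F π i).lintegral_comp (hm i),
          eLpNorm_eq_lintegral_rpow_enorm_toReal (zero_lt_one.trans_le (hp i)).ne' (hp' i), one_div]

/-- Splitting every factor of a mixed moment into its average over the `j`-th coordinate and its
Glauber derivative. -/
lemma partitionMoment_eq_sum [DecidableEq I] [DecidableEq J] (π : J → Setoid I)
    {g : I → (J → Z) → ℝ} (hg : ∀ i, BddMeas (g i)) (j : J) :
    partitionMoment F π g = ∑ V : Finset I,
      partitionMoment F π fun i => if i ∈ V then glauberDeriv F j (g i) else glauberExp F j (g i) := by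
  have hb (V : Finset I) (i : I) :
      BddMeas (if i ∈ V then glauberDeriv F j (g i) else glauberExp F j (g i)) := by
    split_ifs
    exacts [(hg i).glauberDeriv F j, (hg i).glauberExp F j]
  simp only [partitionMoment]
  rw [← integral_finsetSum _ fun V _ => (BddMeas.prod_partition (hb V)).integrable _]
  refine integral_congr_ae (.of_forall fun y => ?_)
  have : ∀ i, g i (fun j => y j i) = glauberDeriv F j (g i) (fun j => y j i)
      + glauberExp F j (g i) (fun j => y j i) := fun i => by simp [glauberDeriv]
  simp only [this]
  rw [Finset.prod_add, Finset.powerset_univ]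
  refine Finset.sum_congr rfl fun V _ => ?_
  rw [← Finset.prod_mul_prod_compl V fun i =>
    (if i ∈ V then glauberDeriv F j (g i) else glauberExp F j (g i)) fun j => y j i]
  congr 1
  · exact Finset.prod_congr rfl fun i hi => by rw [if_pos hi]
  · rw [Finset.compl_eq_univ_sdiff]
    exact Finset.prod_congr rfl fun i hi => by rw [if_neg (Finset.mem_sdiff.1 hi).2]

/-- If the factors indexed by `c` do not depend on the `j`-th coordinate, the mixed moment does not
see how the `j`-th partition acts on `c`. -/
lemma partitionMoment_update_eq [DecidableEq J] (τ : J → Setoid I) {g : I → (J → Z) → ℝ}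
    (hg : ∀ i, BddMeas (g i)) (j : J) {c : Set I}
    (hc : ∀ i ∈ c, ∀ x ξ, g i (Function.update x j ξ) = g i x) {π π' : Setoid I}
    (h : ∀ a b, a ∉ c → b ∉ c → (π a b ↔ π' a b)) :
    partitionMoment F (Function.update τ j π) g = partitionMoment F (Function.update τ j π') g := by
  classical
  obtain ⟨z₀⟩ : Nonempty Z := nonempty_of_isProbabilityMeasure F
  -- `θ` forgets the values that the factors in `c` would read in the `j`-th coordinate
  let θ : J → (I → Z) → I → Z := fun l y i => if l = j ∧ i ∈ c then z₀ else y i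
  have hθ (l : J) : Measurable (θ l) := by
    refine measurable_pi_lambda _ fun i => ?_
    simp only [θ]
    split_ifs <;> fun_prop
  have hinv (y : J → I → Z) :
      ∏ i, g i (fun l => y l i) = ∏ i, g i (fun l => θ l (y l) i) := by
    refine Finset.prod_congr rfl fun i _ => ?_
    by_cases hi : i ∈ c
    · rw [← hc i hi _ z₀]
      congr 1
      funext l
      by_cases hl : l = j
      · subst hl; simp [θ, hi]
      · simp [θ, hl]
    · simp [θ, hi]
  have key (π : Setoid I) : partitionMoment F (Function.update τ j π) g
      = ∫ y : J → I → Z, ∏ i, g i (fun l => y l i)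
        ∂Measure.pi fun l => (partitionMeasure F (Function.update τ j π l)).map (θ l) := by
    have (l : J) : IsProbabilityMeasure
        ((partitionMeasure F (Function.update τ j π l)).map (θ l)) :=
      Measure.isProbabilityMeasure_map (hθ l).aemeasurable
    rw [← Measure.pi_map_pi (fun l => (hθ l).aemeasurable),
      integral_map (Measurable.aemeasurable (by fun_prop))
        (BddMeas.prod_partition hg).1.aestronglyMeasurable, partitionMoment]
    exact integral_congr_ae (.of_forall hinv)
  rw [key, key]
  congr 2
  funext l
  by_cases hl : l = j
  · subst hl
    simp only [Function.update_self, θ, true_and]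
    exact map_partitionMeasure_eq F z₀ h
  · simp [hl]

end PartitionMeasure

/-! ### The lattice of partitions and the law of total cumulance -/

section Partitions

variable {I : Type*}

noncomputable instance Setoid.locallyFiniteOrderOfFinite [Finite I] :
    LocallyFiniteOrder (Setoid I) := by
  classical exact Fintype.toLocallyFiniteOrder

open Classical in
/-- The Möbius function of the lattice of partitions. -/
noncomputable def partitionMoebius [Finite I] (a b : Setoid I) : ℝ := IncidenceAlgebra.mu ℝ a b

open Classical in
lemma sum_partitionMoebius_left [Finite I] (a b : Setoid I) :
    ∑ x ∈ Finset.Icc a b, partitionMoebius x b = if a = b then 1 else 0 :=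
  IncidenceAlgebra.sum_Icc_mu_left a b

open Classical in
lemma sum_partitionMoebius_right [Finite I] (a b : Setoid I) :
    ∑ x ∈ Finset.Icc a b, partitionMoebius a x = if a = b then 1 else 0 :=
  IncidenceAlgebra.sum_Icc_mu_right a b

lemma partitionMoebius_self [Finite I] (a : Setoid I) : partitionMoebius a a = 1 := by
  simpa using sum_partitionMoebius_left a a

/-- A form of Weisner's theorem: if `h` does not distinguish `π` from `π ⊓ a`, its Möbius transform
vanishes at every partition that is not below `a`. -/
lemma sum_partitionMoebius_mul_eq_zero [Finite I] {ρ ρ' a : Setoid I} (h₁ : ρ ≤ a) (h₂ : ¬ρ' ≤ a)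
    {h : Setoid I → ℝ} (hh : ∀ π, h π = h (π ⊓ a)) :
    ∑ π ∈ Finset.Icc ρ ρ', partitionMoebius π ρ' * h π = 0 := by
  classical
  -- the total weight of the `π` with a given `π ⊓ a`: its sums over upper sets vanish,
  -- so it vanishes
  let S : Setoid I → ℝ := fun τ =>
    ∑ π ∈ (Finset.Icc ρ ρ').filter (fun π => π ⊓ a = τ), partitionMoebius π ρ'
  have hS : ∀ τ, S τ = 0 := by
    intro τ
    induction τ using WellFoundedGT.induction with
    | ind τ ih =>
    by_cases hτ : ρ ≤ τ ∧ τ ≤ a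
    · have h3 : ∑ τ' ∈ Finset.univ.filter (τ ≤ ·), S τ'
          = ∑ π ∈ (Finset.Icc ρ ρ').filter (fun π => τ ≤ π ⊓ a), partitionMoebius π ρ' := by
        rw [← Finset.sum_fiberwise_of_maps_to (s := (Finset.Icc ρ ρ').filter (fun π => τ ≤ π ⊓ a))
          (t := Finset.univ.filter (τ ≤ ·)) (g := fun π => π ⊓ a) (fun π hπ =>
            Finset.mem_filter.2 ⟨Finset.mem_univ _, (Finset.mem_filter.1 hπ).2⟩)]
        refine Finset.sum_congr rfl fun τ' hτ' => Finset.sum_congr ?_ fun _ _ => rfl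
        ext π
        simp only [Finset.mem_filter, Finset.mem_univ, true_and] at hτ' ⊢
        constructor
        · rintro ⟨h4, rfl⟩
          exact ⟨⟨h4, hτ'⟩, rfl⟩
        · rintro ⟨⟨h4, -⟩, h5⟩
          exact ⟨h4, h5⟩
      have h4 : (Finset.Icc ρ ρ').filter (fun π => τ ≤ π ⊓ a) = Finset.Icc τ ρ' := by
        ext π
        simp only [Finset.mem_filter, Finset.mem_Icc, le_inf_iff]
        exact ⟨fun h => ⟨h.2.1, h.1.2⟩, fun h => ⟨⟨hτ.1.trans h.1, h.2⟩, h.1, hτ.2⟩⟩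
      rw [h4, sum_partitionMoebius_left, if_neg (by rintro rfl; exact h₂ hτ.2),
        ← Finset.add_sum_erase _ _ (by simp : τ ∈ Finset.univ.filter (τ ≤ ·)),
        Finset.sum_eq_zero, add_zero] at h3
      · exact h3
      · intro τ' hτ'
        simp only [Finset.mem_erase, Finset.mem_filter, Finset.mem_univ, true_and] at hτ'
        exact ih τ' (lt_of_le_of_ne hτ'.2 (Ne.symm hτ'.1))
    · refine Finset.sum_eq_zero fun π hπ => absurd ?_ hτ
      simp only [Finset.mem_filter, Finset.mem_Icc] at hπ
      exact hπ.2 ▸ ⟨le_inf hπ.1.1 h₁, inf_le_right⟩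
  rw [← Finset.sum_fiberwise_of_maps_to (t := Finset.univ) (g := fun π => π ⊓ a)
    (fun π hπ => Finset.mem_univ _)]
  refine Finset.sum_eq_zero fun τ _ => ?_
  rw [← zero_mul (h τ), ← hS τ, Finset.sum_mul]
  exact Finset.sum_congr rfl fun π hπ => by rw [hh π, (Finset.mem_filter.1 hπ).2]

/-- A set `V` meeting all the classes of `ρ` which get merged in `ρ'` has more elements than the
number of classes that disappear. -/
lemma card_quotient_add_one_le [Finite I] {ρ ρ' : Setoid I} (h : ρ < ρ') {V : Finset I}
    (hV : ∀ i, (∃ b, ρ' i b ∧ ¬ρ i b) → ∃ v ∈ V, ρ i v) :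
    Nat.card (Quotient ρ) + 1 ≤ Nat.card (Quotient ρ') + V.card := by
  classical
  have := Fintype.ofFinite (Quotient ρ)
  have := Fintype.ofFinite (Quotient ρ')
  rw [Nat.card_eq_fintype_card, Nat.card_eq_fintype_card]
  obtain ⟨i₀, b₀, hi₀, hb₀⟩ : ∃ i b, ρ' i b ∧ ¬ρ i b := by
    by_contra! hcon
    exact h.not_ge fun a b => hcon a b
  -- the classes of `ρ` that are not classes of `ρ'`; the other ones inject into the classes of
  -- `ρ'`, and miss the class of `i₀`
  let B : Finset (Quotient ρ) := Finset.univ.filter fun q => ∃ b, ρ' q.out b ∧ ¬ρ q.out b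
  have hB : B.card ≤ V.card := by
    refine (Finset.card_le_card fun q hq => ?_).trans (Finset.card_image_le (f := Quotient.mk ρ))
    obtain ⟨v, hv, hqv⟩ := hV q.out (Finset.mem_filter.1 hq).2
    exact Finset.mem_image.2 ⟨v, hv, by rw [← q.out_eq]; exact Quotient.sound (ρ.symm hqv)⟩
  have hgood : ∀ q ∈ Bᶜ, ∀ b, ρ' q.out b → ρ q.out b := by
    intro q hq b hb
    by_contra hcon
    exact Finset.mem_compl.1 hq (Finset.mem_filter.2 ⟨Finset.mem_univ _, b, hb, hcon⟩)
  have hinj : Set.InjOn (fun q : Quotient ρ => Quotient.mk ρ' q.out) (Bᶜ : Finset (Quotient ρ)) := by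
    intro q hq q' _ hqq'
    have := hgood q hq q'.out (Quotient.exact hqq')
    rw [← q.out_eq, ← q'.out_eq]
    exact Quotient.sound this
  have hmiss : Quotient.mk ρ' i₀ ∉ Bᶜ.image (fun q : Quotient ρ => Quotient.mk ρ' q.out) := by
    intro hmem
    obtain ⟨q, hq, hqi⟩ := Finset.mem_image.1 hmem
    have h1 : ρ' q.out i₀ := Quotient.exact hqi
    exact hb₀ (ρ.trans (ρ.symm (hgood q hq _ h1)) (hgood q hq _ (ρ'.trans h1 hi₀)))
  have h1 := Finset.card_lt_univ_of_notMem hmiss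
  rw [Finset.card_image_of_injOn hinj, Finset.card_compl] at h1
  have h2 := Finset.card_le_univ B
  omega

variable [Fintype I]

/-- The weights expressing a cumulant in terms of mixed moments indexed by partitions: the `n`-th
moment of a sum of `q` independent copies is a sum over maps `φ : I → Fin q`, which are grouped by
their kernel. -/
noncomputable def cumulantWeight (π : Setoid I) : ℝ :=
  ∑ q ∈ Finset.range (Fintype.card I + 1), (exists_linearCoeff_weights (Fintype.card I)).choose q *
    Nat.card {φ : I → Fin q // Setoid.ker φ = π}

lemma sum_cumulantWeight [Nonempty I] (ρ : Setoid I) :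
    ∑ π ∈ Finset.Icc ρ ⊤, cumulantWeight π = if Nat.card (Quotient ρ) = 1 then 1 else 0 := by
  classical
  have hcard : Nat.card (Quotient ρ) ≤ Fintype.card I := by
    rw [← Nat.card_eq_fintype_card]
    exact Nat.card_le_card_of_surjective _ Quotient.mk_surjective
  rw [← (exists_linearCoeff_weights (Fintype.card I)).choose_spec _ hcard]
  simp only [cumulantWeight]
  rw [Finset.sum_comm]
  refine Finset.sum_congr rfl fun q _ => ?_
  rw [← Finset.mul_sum]
  congr 1
  have := Fintype.ofFinite (Quotient ρ)
  have h1 : Nat.card {φ : I → Fin q // ρ ≤ Setoid.ker φ} = q ^ Nat.card (Quotient ρ) := by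
    rw [Nat.card_congr (Setoid.liftEquiv ρ), Nat.card_eq_fintype_card, Nat.card_eq_fintype_card,
      Fintype.card_fun, Fintype.card_fin]
  rw [← Nat.cast_pow, ← h1, ← Nat.cast_sum]
  congr 1
  simp only [Nat.card_eq_fintype_card, Fintype.card_subtype]
  rw [Finset.card_eq_sum_card_fiberwise (f := fun φ : I → Fin q => Setoid.ker φ)
    (t := Finset.Icc ρ ⊤) (fun φ hφ => by simpa using hφ)]
  refine Finset.sum_congr rfl fun π hπ => congrArg _ ?_
  ext φ
  simp only [Finset.mem_filter, Finset.mem_univ, true_and]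
  exact ⟨fun h => ⟨h ▸ (Finset.mem_Icc.1 hπ).1, h⟩, fun h => h.2⟩

variable {Z : Type*} [MeasurableSpace Z] (F : Measure Z)

/-- The cumulant conditional on the coordinates from `j` on: these are shared by the copies of the
data according to the partitions `τ`, while in the remaining coordinates the copies in a same class
of `ρ` are glued, and each class counts as one variable of a joint cumulant. -/
noncomputable def partialCumulant {N : ℕ} (j : ℕ) (ρ : Setoid I) (τ : Fin N → Setoid I)
    (g : I → (Fin N → Z) → ℝ) : ℝ :=
  ∑ π ∈ Finset.Icc ρ ⊤,
    cumulantWeight π * partitionMoment F (fun l => if l.1 < j then π else τ l) g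

lemma partialCumulant_zero [Nonempty I] {N : ℕ} (ρ : Setoid I) (τ : Fin N → Setoid I)
    (g : I → (Fin N → Z) → ℝ) :
    partialCumulant F 0 ρ τ g
      = (if Nat.card (Quotient ρ) = 1 then 1 else 0) * partitionMoment F τ g := by
  simp only [partialCumulant, Nat.not_lt_zero, if_false]
  rw [← Finset.sum_mul, sum_cumulantWeight]

lemma partialCumulant_update {N : ℕ} (j : Fin N) (ρ π : Setoid I) (τ : Fin N → Setoid I)
    (g : I → (Fin N → Z) → ℝ) :
    partialCumulant F j ρ (Function.update τ j π) g = ∑ σ ∈ Finset.Icc ρ ⊤, cumulantWeight σ *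
      partitionMoment F (Function.update (fun l => if l.1 < j.1 then σ else τ l) j π) g := by
  refine Finset.sum_congr rfl fun σ _ => ?_
  congr 2
  funext l
  by_cases hl : l = j
  · subst hl; simp
  · simp [hl]

/-- The law of total cumulance, for the disclosure of the `j`-th coordinate. -/
lemma partialCumulant_succ {N : ℕ} (j : Fin N) (ρ : Setoid I) (τ : Fin N → Setoid I)
    (g : I → (Fin N → Z) → ℝ) :
    partialCumulant F (j + 1) ρ τ g = ∑ ρ' ∈ Finset.Icc ρ ⊤, ∑ π ∈ Finset.Icc ρ ρ',
      partitionMoebius π ρ' * partialCumulant F j ρ' (Function.update τ j π) g := by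
  classical
  -- the term in which the coordinates below `j` carry `σ` and the `j`-th one carries `π`
  let r : Setoid I → Setoid I → ℝ := fun σ π => cumulantWeight σ *
      partitionMoment F (Function.update (fun l => if l.1 < j.1 then σ else τ l) j π) g
  have h1 : partialCumulant F (j + 1) ρ τ g = ∑ σ ∈ Finset.Icc ρ ⊤, r σ σ := by
    refine Finset.sum_congr rfl fun σ _ => ?_
    simp only [r]
    congr 2
    funext l
    by_cases hl : l = j
    · subst hl; simp
    · have : l.1 ≠ j.1 := fun h => hl (Fin.ext h)
      simp [hl, show l.1 < j.1 + 1 ↔ l.1 < j.1 by omega]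
  have h2 : ∀ σ ∈ Finset.Icc ρ ⊤, r σ σ = ∑ π ∈ Finset.Icc ρ σ, ∑ ρ' ∈ Finset.Icc π σ,
      partitionMoebius π ρ' * r σ π := by
    intro σ hσ
    simp only [← Finset.sum_mul, sum_partitionMoebius_right, ite_mul, one_mul, zero_mul]
    rw [Finset.sum_ite_eq' _ σ, if_pos (by simpa using hσ)]
  rw [h1, Finset.sum_congr rfl h2]
  simp only [partialCumulant_update, Finset.mul_sum]
  simp only [Finset.sum_sigma']
  refine Finset.sum_bij' (fun x _ => ⟨x.2.2, x.2.1, x.1⟩) (fun x _ => ⟨x.2.2, x.2.1, x.1⟩)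
    ?_ ?_ (fun _ _ => rfl) (fun _ _ => rfl) (fun _ _ => rfl)
  · rintro ⟨σ, π, ρ'⟩ h
    simp only [Finset.mem_sigma, Finset.mem_Icc, le_top, and_true] at h ⊢
    exact ⟨h.2.1.1.trans h.2.2.1, ⟨h.2.1.1, h.2.2.1⟩, h.2.2.2⟩
  · rintro ⟨ρ', π, σ⟩ h
    simp only [Finset.mem_sigma, Finset.mem_Icc, le_top, and_true] at h ⊢
    exact ⟨h.1.trans h.2.2, ⟨h.2.1.1, h.2.1.2.trans h.2.2⟩, h.2.1.2, h.2.2⟩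

variable [IsProbabilityMeasure F]

lemma cumulant_eq_sum_partitionMoment {J : Type*} [Fintype J] {n : ℕ} (hn : 1 ≤ n)
    {f : (J → Z) → ℝ} (hf : BddMeas f) :
    cumulant n f (Measure.pi fun _ => F) = ∑ π : Setoid (Fin n),
      cumulantWeight π * partitionMoment F (fun _ => π) (fun _ => f) := by
  classical
  have hα := (exists_linearCoeff_weights (Fintype.card (Fin n))).choose_spec
  set α := (exists_linearCoeff_weights (Fintype.card (Fin n))).choose with hαdef
  simp only [Fintype.card_fin] at hα
  rw [cumulant_eq_sum_moment _ hf hn hα]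
  have hw (π : Setoid (Fin n)) : cumulantWeight π
      = ∑ q ∈ Finset.range (n + 1), α q * Nat.card {φ : Fin n → Fin q // Setoid.ker φ = π} := by
    rw [cumulantWeight, ← hαdef, Fintype.card_fin]
  simp only [hw, Finset.sum_mul]
  rw [Finset.sum_comm]
  refine Finset.sum_congr rfl fun q _ => ?_
  simp only [mul_assoc]
  rw [← Finset.mul_sum]
  congr 1
  simp only [Fintype.sum_pow]
  rw [integral_finsetSum _ fun φ _ => (BddMeas.prod fun i => hf.comp (measurable_pi_apply
    (φ i))).integrable _]
  simp only [fun φ : Fin n → Fin q => partitionMoment_const_ker F φ (J := J) fun _ => hf]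
  rw [← Finset.sum_fiberwise_of_maps_to (t := Finset.univ)
    (g := fun φ : Fin n → Fin q => Setoid.ker φ) (fun π hπ => Finset.mem_univ _)]
  refine Finset.sum_congr rfl fun π _ => ?_
  rw [Nat.card_eq_fintype_card, Fintype.card_subtype, ← nsmul_eq_mul, ← Finset.sum_const]
  exact Finset.sum_congr rfl fun φ hφ => by rw [(Finset.mem_filter.1 hφ).2]

lemma partialCumulant_eq_sum [DecidableEq I] {N : ℕ} (k : ℕ) (ρ : Setoid I) (τ : Fin N → Setoid I)
    {g : I → (Fin N → Z) → ℝ} (hg : ∀ i, BddMeas (g i)) (j : Fin N) :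
    partialCumulant F k ρ τ g = ∑ V : Finset I, partialCumulant F k ρ τ
      fun i => if i ∈ V then glauberDeriv F j (g i) else glauberExp F j (g i) := by
  simp only [partialCumulant]
  rw [Finset.sum_comm]
  refine Finset.sum_congr rfl fun σ _ => ?_
  rw [← Finset.mul_sum, ← partitionMoment_eq_sum F _ hg j]

/-- When the classes of `ρ` are merged into those of `ρ'` at the `j`-th coordinate, one of the
factors in every merged class has to depend on this coordinate. -/
lemma sum_partitionMoebius_partialCumulant_eq_zero {N : ℕ} (j : Fin N) {ρ ρ' : Setoid I}
    (τ : Fin N → Setoid I) {g : I → (Fin N → Z) → ℝ} (hg : ∀ i, BddMeas (g i)) {i b : I}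
    (hib : ρ' i b) (hib' : ¬ρ i b)
    (hc : ∀ l, ρ i l → ∀ x ξ, g l (Function.update x j ξ) = g l x) :
    ∑ π ∈ Finset.Icc ρ ρ',
      partitionMoebius π ρ' * partialCumulant F j ρ' (Function.update τ j π) g = 0 := by
  -- separate the class of `i` for `ρ` from its complement: the mixed moments do not see this
  refine sum_partitionMoebius_mul_eq_zero (a := Setoid.ker fun l => ρ i l) ?_ ?_ fun π => ?_
  · intro x y hxy
    exact propext ⟨fun h => ρ.trans h hxy, fun h => ρ.trans h (ρ.symm hxy)⟩
  · intro h
    exact hib' ((iff_of_eq (h hib)).1 (ρ.refl i))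
  · simp only [partialCumulant_update]
    refine Finset.sum_congr rfl fun σ _ => ?_
    congr 1
    refine partitionMoment_update_eq F _ hg j (c := {l | ρ i l}) hc fun x y hx hy => ?_
    refine ⟨fun h => ⟨h, ?_⟩, fun h => h.1⟩
    exact propext ⟨fun h' => absurd h' hx, fun h' => absurd h' hy⟩

end Partitions

/-! ### Induction over the coordinates -/

/-- Numbers `d i ≥ 1` can be lowered, while remaining positive, to have any prescribed sum between
their cardinality and their sum. -/
lemma exists_le_sum_eq {I : Type*} [Fintype I] {d : I → ℕ} {T : ℕ} (hd : ∀ i, 1 ≤ d i)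
    (hT : Fintype.card I ≤ T) (hT' : T ≤ ∑ i, d i) :
    ∃ a : I → ℕ, (∀ i, 1 ≤ a i) ∧ (∀ i, a i ≤ d i) ∧ ∑ i, a i = T := by
  classical
  induction T, hT using Nat.le_induction with
  | base => exact ⟨fun _ => 1, fun _ => le_rfl, hd, by simp⟩
  | succ T hT ih =>
    obtain ⟨a, ha, had, hsum⟩ := ih (by omega)
    obtain ⟨i, -, hi⟩ : ∃ i ∈ Finset.univ, a i < d i :=
      Finset.exists_lt_of_sum_lt (by rw [hsum]; exact hT')
    refine ⟨Function.update a i (a i + 1), fun l => ?_, fun l => ?_, ?_⟩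
    · by_cases hl : l = i
      · subst hl; simp
      · simpa [hl] using ha l
    · by_cases hl : l = i
      · subst hl; simpa using hi
      · simpa [hl] using had l
    · rw [Finset.sum_update_of_mem (Finset.mem_univ i), ← hsum,
        ← Finset.add_sum_erase _ a (Finset.mem_univ i), Finset.sdiff_singleton_eq_erase]
      ring

lemma card_quotient_lt {I : Type*} [Finite I] {ρ ρ' : Setoid I} (h : ρ < ρ') :
    Nat.card (Quotient ρ') < Nat.card (Quotient ρ) := by
  by_contra! hcon
  let φ : Quotient ρ → Quotient ρ' := Quotient.map' id fun _ _ hab => h.le hab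
  have hφ : φ.Surjective := by
    rintro ⟨a⟩
    exact ⟨Quotient.mk ρ a, rfl⟩
  have hinj := (hφ.bijective_of_nat_card_le hcon).1
  exact h.not_ge fun a b hab =>
    Quotient.exact (hinj (Quotient.sound hab : φ (Quotient.mk ρ a) = φ (Quotient.mk ρ b)))

section Induction

variable {Z : Type*} [MeasurableSpace Z] (F : Measure Z) {N : ℕ}

/-- `g` is controlled, in all `L^p` norms and also after further differentiation with respect to
coordinates below `j`, by a `d`-fold Glauber derivative of `f` in coordinates from `j` on. -/
def DerivBound (f : (Fin N → Z) → ℝ) (j d : ℕ) (g : (Fin N → Z) → ℝ) : Prop :=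
  BddMeas g ∧ ∃ S : List (Fin N), S.Nodup ∧ S.length = d ∧ (∀ l ∈ S, j ≤ l.1) ∧
    ∀ T : List (Fin N), (∀ l ∈ T, l.1 < j) → ∀ p : ℝ≥0∞, 1 ≤ p → p ≠ ∞ →
      eLpNorm (iterGlauberDeriv F T g) p (Measure.pi fun _ : Fin N => F)
        ≤ eLpNorm (iterGlauberDeriv F T (iterGlauberDeriv F S f)) p (Measure.pi fun _ : Fin N => F)

namespace DerivBound

variable {F} {f g : (Fin N → Z) → ℝ} {d : ℕ}

lemma refl (hf : BddMeas f) : DerivBound F f N 0 f :=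
  ⟨hf, [], List.nodup_nil, rfl, by simp, fun _ _ _ _ _ => le_rfl⟩

lemma of_succ {j : ℕ} (h : DerivBound F f (j + 1) d g) : DerivBound F f j d g := by
  obtain ⟨hg, S, hS, hlen, hj, hT⟩ := h
  exact ⟨hg, S, hS, hlen, fun l hl => (Nat.le_succ j).trans (hj l hl),
    fun T h => hT T fun l hl => (h l hl).trans (Nat.lt_succ_self j)⟩

lemma le_glauberNorm {j : ℕ} (h : DerivBound F f j d g) {p : ℝ≥0∞} (hp : 1 ≤ p) (hp' : p ≠ ∞) :
    eLpNorm g p (Measure.pi fun _ : Fin N => F)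
      ≤ glauberNorm (Measure.pi fun _ : Fin N => F) F (fun i x => x i) d p f := by
  obtain ⟨-, S, hS, hlen, -, hT⟩ := h
  have h := eLpNorm_iterGlauberDeriv_le_glauberNorm F (Measure.pi fun _ : Fin N => F)
    (fun i x => x i) f hS p
  rw [hlen] at h
  exact (hT [] (by simp) p hp hp').trans h

variable [IsProbabilityMeasure F]

lemma glauberDeriv {j : Fin N} (h : DerivBound F f (j + 1) d g) :
    DerivBound F f j (d + 1) (glauberDeriv F j g) := by
  obtain ⟨hg, S, hS, hlen, hj, hT⟩ := h
  refine ⟨hg.glauberDeriv F j, j :: S, List.nodup_cons.2 ⟨fun hmem => ?_, hS⟩, by simp [hlen],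
    fun l hl => ?_, fun T h p hp hp' => ?_⟩
  · exact absurd (hj j hmem) (by omega)
  · rcases List.mem_cons.1 hl with rfl | hl
    exacts [le_rfl, (Nat.le_succ _).trans (hj l hl)]
  · have := hT (T ++ [j]) (fun l hl => ?_) p hp hp'
    · rwa [iterGlauberDeriv_append, iterGlauberDeriv_append] at this
    · rcases List.mem_append.1 hl with hl | hl
      · exact (h l hl).trans (Nat.lt_succ_self _)
      · rw [List.mem_singleton.1 hl]
        exact Nat.lt_succ_self _

lemma glauberExp {j : Fin N} (h : DerivBound F f (j + 1) d g) :
    DerivBound F f j d (glauberExp F j g) := by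
  obtain ⟨hg, S, hS, hlen, hj, hT⟩ := of_succ h
  refine ⟨hg.glauberExp F j, S, hS, hlen, hj, fun T h p hp hp' => ?_⟩
  rw [iterGlauberDeriv_glauberExp_comm F hg fun l hl => Fin.ne_of_lt (h l hl)]
  exact (eLpNorm_glauberExp_le F (hg.iterGlauberDeriv F T) j hp hp').trans (hT T h p hp hp')

end DerivBound

variable {m : ℕ}

/-- The situation after the disclosure of the coordinates from `j` on, if these produced `h` mergers
of classes and led to the partition `ρ`: each merger at some coordinate provides derivatives with
respect to this coordinate, and `d i` counts those acting on the `i`-th factor. -/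
structure Admissible (f : (Fin N → Z) → ℝ) (j : ℕ) (ρ : Setoid (Fin (m + 1))) (h : ℕ)
    (d : Fin (m + 1) → ℕ) (g : Fin (m + 1) → (Fin N → Z) → ℝ) : Prop where
  bound : ∀ i, DerivBound F f j (d i) (g i)
  le : ∀ i, d i ≤ h
  sum : m + 1 + h ≤ ∑ i, d i + Nat.card (Quotient ρ)
  depth : h + Nat.card (Quotient ρ) ≤ m + 1
  cover : ∀ i, d i = 0 → ∀ b, ρ i b → b = i

/-- The contribution to the cumulant bound of the terms with `h` distinct coordinates. -/
noncomputable def levelBound (f : (Fin N → Z) → ℝ) (m h : ℕ) : ℝ≥0∞ :=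
  if h = 0 then 0 else
    ∑ a ∈ (Finset.Nat.antidiagonalTuple (m + 1) (m + h)).filter (fun a => ∀ j, 1 ≤ a j),
      ∏ j, glauberNorm (Measure.pi fun _ : Fin N => F) F (fun i x => x i) (a j)
        (((m + h : ℕ) : ℝ≥0∞) / (a j : ℝ≥0∞)) f

variable [IsProbabilityMeasure F] {f : (Fin N → Z) → ℝ}

variable {F} in
lemma Admissible.enorm_partitionMoment_le (hf : BddMeas f) (hm : 1 ≤ m) {j : ℕ}
    {ρ : Setoid (Fin (m + 1))} {h : ℕ} {d : Fin (m + 1) → ℕ} {g : Fin (m + 1) → (Fin N → Z) → ℝ}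
    (hg : Admissible F f j ρ h d g) (hρ : Nat.card (Quotient ρ) = 1)
    (τ : Fin N → Setoid (Fin (m + 1))) :
    ‖partitionMoment F τ g‖ₑ ≤ (2 ^ m) ^ (m + 1) * levelBound F f m h := by
  have htop (i b : Fin (m + 1)) : ρ i b := by
    have := (Nat.card_eq_one_iff_unique.1 hρ).1
    exact Quotient.exact (Subsingleton.elim (Quotient.mk ρ i) (Quotient.mk ρ b))
  have hd (i : Fin (m + 1)) : 1 ≤ d i := by
    by_contra hcon
    have hc := hg.cover i (by omega)
    have h0 := (hc 0 (htop _ _)).trans (hc (Fin.last m) (htop _ _)).symm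
    exact absurd (congrArg Fin.val h0) (by simp; omega)
  have hh : 1 ≤ h := (hd 0).trans (hg.le 0)
  have hsum := hg.sum
  have hdepth := hg.depth
  rw [hρ] at hsum hdepth
  obtain ⟨a, ha, had, hasum⟩ := exists_le_sum_eq (T := m + h) hd (by simp; omega) (by omega)
  have ha0 (i : Fin (m + 1)) : (a i : ℝ≥0∞) ≠ 0 := by
    have := ha i
    exact_mod_cast (by omega : a i ≠ 0)
  have hale (i : Fin (m + 1)) : a i ≤ m + h :=
    hasum ▸ Finset.single_le_sum (fun _ _ => Nat.zero_le _) (Finset.mem_univ i)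
  let p : Fin (m + 1) → ℝ≥0∞ := fun i => ((m + h : ℕ) : ℝ≥0∞) / (a i : ℝ≥0∞)
  have hp (i : Fin (m + 1)) : 1 ≤ p i := by
    rw [ENNReal.le_div_iff_mul_le (.inl (ha0 i)) (.inl (ENNReal.natCast_ne_top _)), one_mul]
    exact_mod_cast hale i
  have hp' (i : Fin (m + 1)) : p i ≠ ∞ := ENNReal.div_ne_top (ENNReal.natCast_ne_top _) (ha0 i)
  have hpsum : ∑ i, (p i).toReal⁻¹ = 1 := by
    simp only [p, ENNReal.toReal_div, ENNReal.toReal_natCast, inv_div]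
    rw [← Finset.sum_div, ← Nat.cast_sum, hasum]
    exact div_self (by exact_mod_cast (by omega : m + h ≠ 0))
  rw [Real.enorm_eq_ofReal_abs]
  calc ENNReal.ofReal |partitionMoment F τ g|
      ≤ ∏ i, eLpNorm (g i) (p i) (Measure.pi fun _ : Fin N => F) :=
        abs_partitionMoment_le F τ (fun i => (hg.bound i).1) hp hp' hpsum
    _ ≤ ∏ i, (2 ^ m *
          glauberNorm (Measure.pi fun _ : Fin N => F) F (fun i x => x i) (a i) (p i) f) := by
        refine Finset.prod_le_prod' fun i _ => ?_
        refine ((hg.bound i).le_glauberNorm (hp i) (hp' i)).trans ?_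
        refine (glauberNorm_le_of_le F hf (had i) (hp i) (hp' i)).trans ?_
        refine mul_le_mul_left (pow_le_pow_right₀ one_le_two ?_) _
        have := hg.le i
        omega
    _ ≤ (2 ^ m) ^ (m + 1) * levelBound F f m h := by
        rw [Finset.prod_mul_distrib, Finset.prod_const, Finset.card_univ, Fintype.card_fin,
          levelBound, if_neg (by omega)]
        refine mul_le_mul_right ?_ _
        refine Finset.single_le_sum (f := fun a : Fin (m + 1) → ℕ =>
          ∏ j, glauberNorm (Measure.pi fun _ : Fin N => F) F (fun i x => x i) (a j)
            (((m + h : ℕ) : ℝ≥0∞) / (a j : ℝ≥0∞)) f) (fun _ _ => zero_le) ?_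
        exact Finset.mem_filter.2 ⟨Finset.Nat.mem_antidiagonalTuple.2 hasum, ha⟩

variable {F} in
/-- Merging the classes of `ρ` into those of `ρ'` at the `j`-th coordinate, with derivatives on the
factors in `V`. -/
lemma Admissible.merge {j : Fin N} {ρ ρ' : Setoid (Fin (m + 1))} {h : ℕ} {d : Fin (m + 1) → ℕ}
    {g : Fin (m + 1) → (Fin N → Z) → ℝ} (hg : Admissible F f (j + 1) ρ h d g) (hρ : ρ < ρ')
    {V : Finset (Fin (m + 1))} (hV : ∀ i, (∃ b, ρ' i b ∧ ¬ρ i b) → ∃ v ∈ V, ρ i v) :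
    Admissible F f j ρ' (h + 1) (fun i => d i + if i ∈ V then 1 else 0)
      (fun i => if i ∈ V then glauberDeriv F j (g i) else glauberExp F j (g i)) := by
  have hcard := card_quotient_add_one_le hρ hV
  have hcard' := card_quotient_lt hρ
  refine ⟨fun i => ?_, fun i => ?_, ?_, ?_, fun i hi b hb => ?_⟩
  · split_ifs
    exacts [(hg.bound i).glauberDeriv, (hg.bound i).glauberExp]
  · have := hg.le i
    split_ifs <;> omega
  · have := hg.sum
    rw [Finset.sum_add_distrib, Finset.sum_ite_mem, Finset.univ_inter, Finset.sum_const,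
      smul_eq_mul, mul_one]
    omega
  · have := hg.depth
    omega
  · obtain ⟨hdi, hiV⟩ : d i = 0 ∧ i ∉ V := by
      by_cases hiV : i ∈ V
      · simp [hiV] at hi
      · simpa [hiV] using hi
    by_contra hbi
    have hib : ¬ρ i b := fun h' => hbi (hg.cover i hdi b h')
    obtain ⟨v, hv, hiv⟩ := hV i ⟨b, hb, hib⟩
    exact hiV (hg.cover i hdi v hiv ▸ hv)

/-- The total mass of the Möbius function, times the number of subsets of the set of factors. -/
noncomputable def moebiusMass (m : ℕ) : ℝ≥0 :=
  2 ^ (m + 1) * ∑ ρ' : Setoid (Fin (m + 1)), ∑ π : Setoid (Fin (m + 1)), ‖partitionMoebius π ρ'‖₊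

/-- Each coordinate either leaves the number `h` of mergers unchanged or increases it while
decreasing the number of classes, so that `r` further mergers among `j` coordinates cost a factor of order
`j ^ r`. -/
theorem Admissible.enorm_partialCumulant_le (hf : BddMeas f) (hm : 1 ≤ m) {j : ℕ} (hj : j ≤ N)
    (τ : Fin N → Setoid (Fin (m + 1))) {ρ : Setoid (Fin (m + 1))} {h : ℕ} {d : Fin (m + 1) → ℕ}
    {g : Fin (m + 1) → (Fin N → Z) → ℝ} (hg : Admissible F f j ρ h d g) :
    ‖partialCumulant F j ρ τ g‖ₑ ≤ (2 ^ m) ^ (m + 1) *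
      ∑ r ∈ Finset.range (Nat.card (Quotient ρ)),
        ((moebiusMass m : ℝ≥0∞) * j) ^ r * levelBound F f m (h + r) := by
  classical
  induction j generalizing τ ρ h d g with
  | zero =>
    rw [partialCumulant_zero]
    split_ifs with hρ
    · rw [hρ, one_mul]
      simpa using hg.enorm_partitionMoment_le hf hm hρ τ
    · simp
  | succ j ih =>
    have hjN : j < N := hj
    let j' : Fin N := ⟨j, hjN⟩
    have ih := ih hjN.le
    set D : ℝ≥0∞ := (2 ^ m) ^ (m + 1)
    set K : ℝ≥0∞ := (moebiusMass m : ℝ≥0∞) with hK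
    set L : ℕ → ℝ≥0∞ := levelBound F f m
    obtain ⟨c, hc⟩ : ∃ c, Nat.card (Quotient ρ) = c + 1 :=
      ⟨_, (Nat.succ_pred_eq_of_pos Nat.card_pos).symm⟩
    -- the partition stays the same, and no derivative appears
    have hstay : ‖partialCumulant F j ρ (Function.update τ j' ρ) g‖ₑ
        ≤ D * ∑ r ∈ Finset.range (c + 1), (K * j) ^ r * L (h + r) := by
      rw [← hc]
      exact ih _ ⟨fun i => (hg.bound i).of_succ, hg.le, hg.sum, hg.depth, hg.cover⟩
    -- the partition gets strictly coarser: expand each factor, and discard the vanishing terms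
    have hmerge : ∀ ρ' ∈ (Finset.Icc ρ ⊤).erase ρ,
        ‖∑ π ∈ Finset.Icc ρ ρ',
          partitionMoebius π ρ' * partialCumulant F j ρ' (Function.update τ j' π) g‖ₑ
        ≤ 2 ^ (m + 1) * (∑ π, ‖partitionMoebius π ρ'‖ₑ) *
          (D * ∑ r ∈ Finset.range c, (K * j) ^ r * L (h + 1 + r)) := by
      intro ρ' hρ'
      have hlt : ρ < ρ' := by
        simp only [Finset.mem_erase, Finset.mem_Icc, le_top, and_true] at hρ'
        exact lt_of_le_of_ne hρ'.2 (Ne.symm hρ'.1)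
      have hb := fun i => (hg.bound i).1
      have hsplit : ∑ π ∈ Finset.Icc ρ ρ',
          partitionMoebius π ρ' * partialCumulant F j ρ' (Function.update τ j' π) g
          = ∑ V : Finset (Fin (m + 1)), ∑ π ∈ Finset.Icc ρ ρ', partitionMoebius π ρ' *
            partialCumulant F j ρ' (Function.update τ j' π) (fun i =>
              if i ∈ V then glauberDeriv F j' (g i) else glauberExp F j' (g i)) := by
        rw [Finset.sum_comm]
        refine Finset.sum_congr rfl fun π _ => ?_
        rw [partialCumulant_eq_sum F j ρ' _ hb j', Finset.mul_sum]
      rw [hsplit]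
      have hV (V : Finset (Fin (m + 1))) : ‖∑ π ∈ Finset.Icc ρ ρ', partitionMoebius π ρ' *
          partialCumulant F j ρ' (Function.update τ j' π) (fun i =>
            if i ∈ V then glauberDeriv F j' (g i) else glauberExp F j' (g i))‖ₑ
          ≤ (∑ π, ‖partitionMoebius π ρ'‖ₑ) *
            (D * ∑ r ∈ Finset.range c, (K * j) ^ r * L (h + 1 + r)) := by
        by_cases hcov : ∀ i, (∃ b, ρ' i b ∧ ¬ρ i b) → ∃ v ∈ V, ρ i v
        · have hadm := Admissible.merge (j := j') hg hlt hcov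
          have hcard : Nat.card (Quotient ρ') ≤ c := by
            have := card_quotient_lt hlt
            omega
          refine (enorm_sum_le _ _).trans ?_
          rw [Finset.sum_mul]
          refine (Finset.sum_le_sum fun π _ => ?_).trans
            (Finset.sum_le_sum_of_subset (Finset.subset_univ _))
          rw [enorm_mul]
          refine mul_le_mul_right ((ih _ hadm).trans (mul_le_mul_right ?_ _)) _
          exact Finset.sum_le_sum_of_subset (Finset.range_mono hcard)
        · push Not at hcov
          obtain ⟨i, ⟨b, hib, hib'⟩, hiV⟩ := hcov
          rw [sum_partitionMoebius_partialCumulant_eq_zero F j' τ (fun l => ?_) hib hib'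
            fun l hl x ξ => ?_, enorm_zero]
          · exact zero_le
          · split_ifs
            exacts [(hb l).glauberDeriv F j', (hb l).glauberExp F j']
          · rw [if_neg fun hlV => hiV l hlV hl]
            exact glauberExp_update F (g l) j' x ξ
      refine (enorm_sum_le _ _).trans ((Finset.sum_le_sum fun V _ => hV V).trans ?_)
      rw [Finset.sum_const, Finset.card_univ, Fintype.card_finset, Fintype.card_fin, nsmul_eq_mul,
        mul_assoc]
      simp
    have hmass : ∑ ρ' ∈ (Finset.Icc ρ ⊤).erase ρ,
        (2 ^ (m + 1) * ∑ π, ‖partitionMoebius π ρ'‖ₑ) ≤ K := by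
      rw [hK, moebiusMass, ← Finset.mul_sum]
      push_cast
      exact mul_le_mul_right (Finset.sum_le_sum_of_subset (Finset.subset_univ _)) _
    have hsucc : partialCumulant F (j + 1) ρ τ g
        = ∑ ρ' ∈ Finset.Icc ρ ⊤, ∑ π ∈ Finset.Icc ρ ρ',
          partitionMoebius π ρ' * partialCumulant F j ρ' (Function.update τ j' π) g :=
      partialCumulant_succ F j' ρ τ g
    rw [hsucc, ← Finset.add_sum_erase _ _ (by simp : ρ ∈ Finset.Icc ρ ⊤), Finset.Icc_self,
      Finset.sum_singleton, partitionMoebius_self, one_mul, hc]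
    calc _ ≤ D * ∑ r ∈ Finset.range (c + 1), (K * j) ^ r * L (h + r)
          + K * (D * ∑ r ∈ Finset.range c, (K * j) ^ r * L (h + 1 + r)) := by
          refine (enorm_add_le _ _).trans (add_le_add hstay ?_)
          refine (enorm_sum_le _ _).trans ((Finset.sum_le_sum hmerge).trans ?_)
          rw [← Finset.sum_mul]
          exact mul_le_mul_left hmass _
      _ = D * (∑ r ∈ Finset.range c, ((K * j) ^ r * (K * j + K)) * L (h + (r + 1)) + L h) := by
          rw [Finset.sum_range_succ']
          rw [mul_left_comm, ← mul_add, Finset.mul_sum, add_right_comm, ← Finset.sum_add_distrib,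
            pow_zero, one_mul, add_zero]
          congr 2
          refine Finset.sum_congr rfl fun r _ => ?_
          rw [add_assoc h 1 r, add_comm 1 r]
          ring
      _ ≤ _ := by
          rw [Finset.sum_range_succ']
          refine mul_le_mul_right (add_le_add (Finset.sum_le_sum fun r _ => ?_) (by simp)) _
          refine mul_le_mul_left ?_ _
          rw [pow_succ]
          refine mul_le_mul' (pow_le_pow_left' (mul_le_mul_right ?_ _) _) ?_
          · exact_mod_cast Nat.le_succ j
          · push_cast
            rw [mul_add, mul_one]

end Induction

/-! ### Transfer from the product space -/

section Transfer

variable {Z : Type*} [MeasurableSpace Z] (F : Measure Z) {N : ℕ}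

variable {Ω : Type*} [MeasurableSpace Ω] {P : Measure Ω} {z : Fin N → Ω → Z}
  {f f' : (Fin N → Z) → ℝ}

lemma cumulant_eq_of_map_eq (hz : ∀ i, Measurable (z i))
    (hmap : P.map (fun ω i => z i ω) = Measure.pi fun _ => F) (hf' : BddMeas f')
    (hff' : f =ᵐ[Measure.pi fun _ : Fin N => F] f') (n : ℕ) :
    cumulant n (fun ω => f (fun i => z i ω)) P = cumulant n f' (Measure.pi fun _ => F) := by
  have hZ : Measurable fun ω i => z i ω := measurable_pi_lambda _ hz
  have h : cgf (fun ω => f (fun i => z i ω)) P = cgf f' (Measure.pi fun _ => F) := by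
    funext t
    rw [cgf, cgf, ← hmap,
      mgf_map hZ.aemeasurable (hf'.1.const_mul t).exp.aestronglyMeasurable]
    rw [← hmap] at hff'
    exact congrArg Real.log (mgf_congr (ae_of_ae_map hZ.aemeasurable hff'))
  rw [cumulant, cumulant, h]

variable [IsProbabilityMeasure F]

/-- The cumulant bound on the product space, for a bounded function. -/
lemma enorm_cumulant_le {m : ℕ} (hm : 1 ≤ m) (hf : BddMeas f) :
    ‖cumulant (m + 1) f (Measure.pi fun _ => F)‖ₑ ≤
      ((2 ^ m) ^ (m + 1) * max 1 (moebiusMass m) ^ m : ℝ≥0) *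
        ∑ k ∈ Finset.range m, (N : ℝ≥0∞) ^ (k + 1) * levelBound F f m (k + 1) := by
  have h0 : cumulant (m + 1) f (Measure.pi fun _ => F)
      = partialCumulant (N := N) F N ⊥ (fun _ => ⊥) (fun _ : Fin (m + 1) => f) := by
    rw [cumulant_eq_sum_partitionMoment F (by omega) hf, partialCumulant]
    refine Finset.sum_congr (by ext; simp) fun π _ => ?_
    simp
  have hcard : Nat.card (Quotient (⊥ : Setoid (Fin (m + 1)))) = m + 1 := by
    have hbij : Function.Bijective (Quotient.mk (⊥ : Setoid (Fin (m + 1)))) :=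
      ⟨fun a b h => Quotient.exact h, Quotient.mk_surjective⟩
    rw [← Nat.card_eq_of_bijective _ hbij, Nat.card_eq_fintype_card, Fintype.card_fin]
  have hadm : Admissible F f N (⊥ : Setoid (Fin (m + 1))) 0 (fun _ => 0) (fun _ => f) :=
    ⟨fun _ => .refl hf, fun _ => le_rfl, by simp [hcard], by simp [hcard], fun i _ b h => Eq.symm h⟩
  rw [h0]
  refine (hadm.enorm_partialCumulant_le F hf hm le_rfl _).trans ?_
  rw [hcard, Finset.sum_range_succ']
  push_cast
  rw [mul_assoc]
  refine mul_le_mul_right ?_ _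
  rw [show levelBound F f m 0 = 0 from if_pos rfl, mul_zero, add_zero, Finset.mul_sum]
  refine Finset.sum_le_sum fun k hk => ?_
  rw [zero_add, mul_pow, mul_assoc]
  refine mul_le_mul_left ?_ _
  exact (pow_le_pow_left' (le_max_right _ _) _).trans
    (pow_le_pow_right₀ (le_max_left _ _) (Finset.mem_range.1 hk))

lemma glauberNorm_eq_of_map_eq (hz : ∀ i, Measurable (z i))
    (hmap : P.map (fun ω i => z i ω) = Measure.pi fun _ => F) (hf' : BddMeas f')
    (hff' : f =ᵐ[Measure.pi fun _ : Fin N => F] f') (n : ℕ) (p : ℝ≥0∞) :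
    glauberNorm P F z n p f
      = glauberNorm (Measure.pi fun _ : Fin N => F) F (fun i x => x i) n p f' := by
  have hZ : Measurable fun ω i => z i ω := measurable_pi_lambda _ hz
  refine iSup_congr fun j => ?_
  have h := iterGlauberDeriv_congr_ae F hff' (List.ofFn j)
  have h' := (hf'.iterGlauberDeriv F (List.ofFn j)).1.aestronglyMeasurable
    (μ := P.map fun ω i => z i ω)
  rw [← hmap] at h
  have h'' : (fun ω => iterGlauberDeriv F (List.ofFn j) f (fun i => z i ω))
      =ᵐ[P] fun ω => iterGlauberDeriv F (List.ofFn j) f' (fun i => z i ω) :=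
    ae_of_ae_map hZ.aemeasurable h
  rw [eLpNorm_congr_ae h'', ← hmap]
  exact (eLpNorm_map_measure h' hZ.aemeasurable).symm

end Transfer

lemma cumulant_const {Ω : Type*} [MeasurableSpace Ω] (P : Measure Ω) [IsProbabilityMeasure P]
    (c : ℝ) {n : ℕ} (hn : 2 ≤ n) : cumulant n (fun _ => c) P = 0 := by
  obtain ⟨n, rfl⟩ : ∃ k, n = k + 2 := ⟨n - 2, by omega⟩
  have h : cgf (fun _ : Ω => c) P = fun t => t * c := by
    funext t
    simp
  have h' : deriv (fun t : ℝ => t * c) = fun _ => c := by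
    funext t
    simp
  rw [cumulant, h, iteratedDeriv_succ', h', iteratedDeriv_const]
  simp

theorem theorem2p2 (m : ℕ) (hm : 1 ≤ m) :
    ∃ C : ℝ≥0, ∀ (Ω Z : Type*) [MeasurableSpace Ω] [MeasurableSpace Z]
      (P : Measure Ω) [IsProbabilityMeasure P] (F : Measure Z) (N : ℕ)
      (z : Fin N → Ω → Z) (f : (Fin N → Z) → ℝ),
      (∀ i, Measurable (z i)) → (∀ i, P.map (z i) = F) → iIndepFun z P →
      Measurable f → (∃ M : ℝ, ∀ᵐ ω ∂P, |f (fun i => z i ω)| ≤ M) →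
      ENNReal.ofReal |cumulant (m + 1) (fun ω => f (fun i => z i ω)) P| ≤
        C * ∑ k ∈ Finset.range m, (N : ℝ≥0∞) ^ (k + 1) *
          ∑ a ∈ (Finset.Nat.antidiagonalTuple (m + 1) (m + k + 1)).filter (fun a => ∀ j, 1 ≤ a j),
            ∏ j, glauberNorm P F z (a j) (((m + k + 1 : ℕ) : ℝ≥0∞) / (a j : ℝ≥0∞)) f := by
  refine ⟨(2 ^ m) ^ (m + 1) * max 1 (moebiusMass m) ^ m, ?_⟩
  intro Ω Z _ _ P _ F N z f hz hF hind hf ⟨M, hM⟩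
  rcases N.eq_zero_or_pos with rfl | hN
  · -- without data, the random variable is constant, and `F` need not be a probability measure
    have hconst : (fun ω => f (fun i => z i ω)) = fun _ : Ω => f (fun i => i.elim0) := by
      funext ω
      exact congrArg f (funext fun i => i.elim0)
    rw [hconst, cumulant_const P _ (by omega)]
    simp
  have : IsProbabilityMeasure F :=
    hF ⟨0, hN⟩ ▸ Measure.isProbabilityMeasure_map (hz _).aemeasurable
  have hmap : P.map (fun ω i => z i ω) = Measure.pi fun _ => F := by
    rw [hind.map_fun_eq_pi_map fun i => (hz i).aemeasurable]
    simp only [hF]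
  -- truncation makes `f` bounded everywhere, without changing the random variable
  let f' : (Fin N → Z) → ℝ := fun x => max (-M) (min M (f x))
  have hff' : f =ᵐ[Measure.pi fun _ : Fin N => F] f' := by
    rw [← hmap]
    have hset : MeasurableSet {x | |f x| ≤ M} := measurableSet_le hf.abs measurable_const
    have := (ae_map_iff (measurable_pi_lambda _ hz).aemeasurable hset).2 hM
    filter_upwards [this] with x hx
    have := abs_le.1 hx
    simp only [f']
    rw [min_eq_right this.2, max_eq_right this.1]
  have hM0 : 0 ≤ M := by
    obtain ⟨ω, hω⟩ := hM.exists
    exact (abs_nonneg _).trans hω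
  have hf' : BddMeas f' := by
    refine ⟨measurable_const.max (measurable_const.min hf), M, fun x => abs_le.2 ⟨?_, ?_⟩⟩
    · exact le_max_left _ _
    · exact max_le (by linarith) (min_le_left _ _)
  rw [cumulant_eq_of_map_eq F hz hmap hf' hff', ← Real.enorm_eq_ofReal_abs]
  simp only [glauberNorm_eq_of_map_eq F hz hmap hf' hff']
  exact enorm_cumulant_le F hm hf'
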